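/- Let $a>0$ and let $\mu$ be a non-zero positive finite Borel measure on $[a,\infty)$. Put $$g(x)=\int_a^\infty \frac{d\mu(t)}{x-it},\qquad x\in\mathbb{R}.$$ Then $g\in L^2(\mathbb{R})$, and for all $\alpha,\beta>0$ with $\alpha\beta\le 1$ the Gabor system $$\mathcal{G}(g;\alpha,\beta)=\left\{e^{2\pi i\beta n x}g(x-\alpha m)\right\}_{m,n\in\mathbb{Z}}$$ is a frame in $L^2(\mathbb{R})$; that is, there are constants $A,B>0$ such that for all $h\in L^2(\mathbb{R})$ $$A\|h\|^2\le\sum_{m,n\in\mathbb{Z}}\left|\int_{\mathbb{R}}h(x)\,\overline{e^{2\pi i\beta n x}g(x-\alpha m)}\,dx\right|^2\le B\|h\|^2 .$$ -/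

import Mathlib

open MeasureTheory

noncomputable section

/-- A family `f` in a Hilbert space `H` is a frame if there are `A, B > 0` such that
`A ‖h‖² ≤ ∑ |(h, f i)|² ≤ B ‖h‖²` for all `h`, where the sum converges. -/
def IsHilbertFrame {ι H : Type*} [NormedAddCommGroup H] [InnerProductSpace ℂ H]
    (f : ι → H) : Prop :=
  ∃ A B : ℝ, 0 < A ∧ 0 < B ∧ ∀ h : H,
    Summable (fun i => ‖inner ℂ (f i) h‖ ^ 2) ∧
    A * ‖h‖ ^ 2 ≤ ∑' i, ‖inner ℂ (f i) h‖ ^ 2 ∧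
    ∑' i, ‖inner ℂ (f i) h‖ ^ 2 ≤ B * ‖h‖ ^ 2

/-- The time-frequency shift `π_{t,ω} g (x) = exp(2π i ω x) g(x - t)`. -/
def timeFreqShift (t ω : ℝ) (g : ℝ → ℂ) : ℝ → ℂ :=
  fun x => Complex.exp (2 * Real.pi * Complex.I * ω * x) * g (x - t)

theorem memLp_timeFreqShift (t ω : ℝ) {g : ℝ → ℂ} (hg : MemLp g 2 volume) :
    MemLp (timeFreqShift t ω g) 2 volume := by
  have h1 : MemLp (fun x => g (x - t)) 2 volume :=
    hg.comp_measurePreserving (measurePreserving_sub_right volume t)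
  have hc : Continuous fun x : ℝ =>
      Complex.exp (2 * Real.pi * Complex.I * ω * (x : ℂ)) := by fun_prop
  refine h1.mono (hc.aestronglyMeasurable.mul h1.aestronglyMeasurable) ?_
  refine Filter.Eventually.of_forall fun x => ?_
  have h2 : (2 * Real.pi * Complex.I * ω * x : ℂ)
      = ((2 * Real.pi * ω * x : ℝ) : ℂ) * Complex.I := by push_cast; ring
  simp only [timeFreqShift, norm_mul, h2, Complex.norm_exp_ofReal_mul_I, one_mul, le_refl]

/-- The Gabor system `{π_{α m, β n} g}`, `m, n ∈ ℤ`, as a family of elements of `L²(ℝ)`. -/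
def gaborSystem (g : ℝ → ℂ) (hg : MemLp g 2 volume) (α β : ℝ) :
    ℤ × ℤ → Lp ℂ 2 (volume : Measure ℝ) :=
  fun p => (memLp_timeFreqShift (α * p.1) (β * p.2) hg).toLp

/-- `g` lies in `L²(ℝ)` and its Gabor system with parameters `α, β` is a frame in `L²(ℝ)`. -/
def IsGaborFrame (g : ℝ → ℂ) (α β : ℝ) : Prop :=
  ∃ hg : MemLp g 2 volume, IsHilbertFrame (gaborSystem g hg α β)

/-- The Cauchy transform `x ↦ ∫ dμ(t) / (x - i t)` of a measure on the line. -/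
def cauchyTransform (μ : Measure ℝ) : ℝ → ℂ :=
  fun x => ∫ t : ℝ, 1 / ((x : ℂ) - Complex.I * (t : ℂ)) ∂μ

end

open scoped ENNReal FourierTransform Topology
open MeasureTheory Filter

/-! For t > 0, 1/(x - it) = 2πi ∫_0^∞ e^{-2πtξ} e^{-2πixξ} dξ, so g is the Fourier transform of
2πiΦ, where Φ is the Laplace transform of μ at 2πξ, cut off to ξ > 0. By Plancherel the Gabor
coefficients of g become, up to phases, those of 2πiΦ with translations by βn and modulations by αm.
Put p = 1/α and let H be the inverse Fourier transform of h. Parseval in m turns the square sum into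
a constant times the integral over x in (0, p] of Σ_n |Σ_k Φ(x + kp + βn) H(x + kp)|². It remains to
bound the matrices Φ(x + kp + βn) above and below on ℓ²(ℤ), uniformly in x.

The upper bound is the Schur test with exponential decay. For the lower bound keep, for each k, the
row n(k) with x + kp + βn(k) in (0, β]. As β ≤ p, the retained square matrix is upper triangular,
with diagonal at least Φ(β). Since Φ is positive, decreasing and log-convex, Kaluza's sign lemma
(`IsKaluzaMatrix.inv_apply_nonpos`) makes the off-diagonal entries of the inverse nonpositive, and
its row and column sums are nonnegative. Absolute row and column sums of the inverse are then at
most 2/Φ(β), and the Schur test bounds the inverse. This is done on finite sections, whose neglected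
columns vanish in the limit. -/

/-! ### Weighted Cauchy–Schwarz and the Schur test. -/

theorem ENNReal.sq_tsum_mul_le {κ : Type*} (w f : κ → ℝ≥0∞) :
    (∑' k, w k * f k) ^ 2 ≤ (∑' k, w k) * ∑' k, w k * f k ^ 2 := by
  have h2 : ∀ a b : ℝ≥0∞, 2 * (a * b) ≤ a ^ 2 + b ^ 2 := fun a b => by
    wlog h : a ≤ b generalizing a b
    · rw [mul_comm a b, add_comm]; exact this b a (le_of_not_ge h)
    obtain ⟨d, rfl⟩ := exists_add_of_le h
    calc 2 * (a * (a + d)) ≤ 2 * (a * (a + d)) + d ^ 2 := le_self_add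
      _ = a ^ 2 + (a + d) ^ 2 := by ring
  -- Doubling lets the square, expanded as a double sum, be bounded termwise by 2ab ≤ a² + b².
  have key : 2 * (∑' k, w k * f k) ^ 2 ≤ 2 * ((∑' k, w k) * ∑' k, w k * f k ^ 2) := by
    calc 2 * (∑' k, w k * f k) ^ 2
        = ∑' k, ∑' l, w k * w l * (2 * (f k * f l)) := by
          rw [sq, ← ENNReal.tsum_mul_right, ← ENNReal.tsum_mul_left]
          refine tsum_congr fun k => ?_
          rw [← ENNReal.tsum_mul_left, ← ENNReal.tsum_mul_left]
          exact tsum_congr fun l => by ring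
      _ ≤ ∑' k, ∑' l, w k * w l * (f k ^ 2 + f l ^ 2) := by
          gcongr; exact h2 _ _
      _ = ∑' k, ∑' l, w l * (w k * f k ^ 2) + ∑' k, ∑' l, w k * (w l * f l ^ 2) := by
          rw [← ENNReal.tsum_add]
          refine tsum_congr fun k => ?_
          rw [← ENNReal.tsum_add]
          exact tsum_congr fun l => by ring
      _ = 2 * ((∑' k, w k) * ∑' k, w k * f k ^ 2) := by
          simp_rw [ENNReal.tsum_mul_right, ENNReal.tsum_mul_left, ENNReal.tsum_mul_right]
          ring
  exact (ENNReal.mul_le_mul_iff_right (by norm_num) (by norm_num)).1 key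

/-- The Schur test. -/
theorem ENNReal.schur_test {ι κ : Type*} (w : ι → κ → ℝ≥0∞) (f : κ → ℝ≥0∞) (A B : ℝ≥0∞)
    (hA : ∀ i, ∑' k, w i k ≤ A) (hB : ∀ k, ∑' i, w i k ≤ B) :
    ∑' i, (∑' k, w i k * f k) ^ 2 ≤ A * B * ∑' k, f k ^ 2 := by
  calc ∑' i, (∑' k, w i k * f k) ^ 2 ≤ ∑' i, A * ∑' k, w i k * f k ^ 2 := by
        gcongr with i
        exact (ENNReal.sq_tsum_mul_le _ _).trans (by gcongr; exact hA i)
    _ = A * ∑' k, (∑' i, w i k) * f k ^ 2 := by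
        rw [ENNReal.tsum_mul_left, ENNReal.tsum_comm]
        simp_rw [ENNReal.tsum_mul_right]
    _ ≤ A * ∑' k, B * f k ^ 2 := by
        gcongr with k; exact hB k
    _ = A * B * ∑' k, f k ^ 2 := by rw [ENNReal.tsum_mul_left, mul_assoc]

/-! ### Kaluza matrices and the norm of their inverses. -/

/-- An upper triangular matrix with positive, monotone and log-convex entries. -/
structure IsKaluzaMatrix {ι : Type*} [LinearOrder ι] (A : Matrix ι ι ℝ) : Prop where
  eq_zero : ∀ i j, j < i → A i j = 0
  pos : ∀ i j, i ≤ j → 0 < A i j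
  anti : ∀ i j k, i ≤ j → j ≤ k → A i k ≤ A i j
  mono : ∀ i j k, i ≤ j → j ≤ k → A i k ≤ A j k
  ratio : ∀ i j k l, i ≤ j → j ≤ k → k ≤ l → A j l * A i k ≤ A i l * A j k

namespace IsKaluzaMatrix

variable {ι : Type*} [LinearOrder ι] [Fintype ι] {A : Matrix ι ι ℝ}

theorem isUnit_det (hA : IsKaluzaMatrix A) : IsUnit A.det := by
  rw [Matrix.det_of_isUpperTriangular (fun i j h => hA.eq_zero i j h), isUnit_iff_ne_zero]
  exact Finset.prod_ne_zero_iff.2 fun i _ => (hA.pos i i le_rfl).ne'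

theorem inv_apply_eq_zero (hA : IsKaluzaMatrix A) {i j : ι} (h : j < i) : A⁻¹ i j = 0 := by
  have := A.invertibleOfIsUnitDet hA.isUnit_det
  exact Matrix.blockTriangular_inv_of_blockTriangular (b := id)
    (fun i j h => hA.eq_zero i j h) h

theorem sum_inv_mul (hA : IsKaluzaMatrix A) (i j : ι) :
    ∑ k, A⁻¹ i k * A k j = if i = j then 1 else 0 := by
  rw [← Matrix.mul_apply, Matrix.nonsing_inv_mul A hA.isUnit_det, Matrix.one_apply]

theorem sum_mul_inv (hA : IsKaluzaMatrix A) (i j : ι) :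
    ∑ k, A i k * A⁻¹ k j = if i = j then 1 else 0 := by
  rw [← Matrix.mul_apply, Matrix.mul_nonsing_inv A hA.isUnit_det, Matrix.one_apply]

theorem inv_apply_self (hA : IsKaluzaMatrix A) (i : ι) : A⁻¹ i i = (A i i)⁻¹ := by
  have h := hA.sum_inv_mul i i
  rw [if_pos rfl, Finset.sum_eq_single i] at h
  · exact eq_inv_of_mul_eq_one_left h
  · intro k _ hk
    rcases lt_or_gt_of_ne hk with hk | hk
    · rw [hA.inv_apply_eq_zero hk, zero_mul]
    · rw [hA.eq_zero k i hk, mul_zero]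
  · simp

/-- Kaluza's sign lemma. -/
theorem inv_apply_nonpos (hA : IsKaluzaMatrix A) {i l : ι} (hil : i < l) : A⁻¹ i l ≤ 0 := by
  induction l using WellFoundedLT.induction with
  | ind l ih =>
  have hne : (Finset.univ.filter (· < l)).Nonempty := ⟨i, by simpa using hil⟩
  set m := (Finset.univ.filter (· < l)).max' hne with hm
  have hml : m < l := (Finset.mem_filter.1 (Finset.max'_mem _ hne)).2
  have hmax : ∀ k, k < l → k ≤ m := fun k hk => Finset.le_max' _ _ (by simpa using hk)
  have him : i ≤ m := hmax i hil
  -- Here m is the predecessor of l. Columns l and m of A⁻¹A = 1 are combined so that the term k = i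
  -- cancels. For i < k < l the bracket is nonpositive by `ratio`, and so is A⁻¹ i k by induction;
  -- only k = l is left to carry the sign.
  have hsum : ∑ k, A⁻¹ i k * (A k l * A i m - A k m * A i l) ≤ 0 := by
    have : ∑ k, A⁻¹ i k * (A k l * A i m - A k m * A i l)
        = (∑ k, A⁻¹ i k * A k l) * A i m - (∑ k, A⁻¹ i k * A k m) * A i l := by
      rw [Finset.sum_mul, Finset.sum_mul, ← Finset.sum_sub_distrib]
      exact Finset.sum_congr rfl fun k _ => by ring
    rw [this, hA.sum_inv_mul, hA.sum_inv_mul, if_neg hil.ne, zero_mul, zero_sub, neg_nonpos]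
    exact mul_nonneg (by split_ifs <;> norm_num) (hA.pos i l hil.le).le
  have hle : A⁻¹ i l * (A l l * A i m - A l m * A i l)
      ≤ ∑ k, A⁻¹ i k * (A k l * A i m - A k m * A i l) := by
    rw [← Finset.add_sum_erase _ _ (Finset.mem_univ l)]
    refine le_add_of_nonneg_right (Finset.sum_nonneg fun k hk => ?_)
    have hkl : k ≠ l := (Finset.mem_erase.1 hk).1
    rcases lt_or_gt_of_ne hkl with hkl | hkl
    · rcases lt_trichotomy k i with hki | rfl | hki
      · rw [hA.inv_apply_eq_zero hki, zero_mul]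
      · rw [show A k l * A k m - A k m * A k l = 0 by ring, mul_zero]
      · refine mul_nonneg_of_nonpos_of_nonpos (ih k hkl hki) ?_
        have := hA.ratio i k m l hki.le (hmax k hkl) hml.le
        linarith
    · rw [hA.eq_zero k l hkl, hA.eq_zero k m (hml.trans hkl)]; simp
  rw [hA.eq_zero l m hml, zero_mul, sub_zero] at hle
  have hpos : 0 < A l l * A i m := mul_pos (hA.pos l l le_rfl) (hA.pos i m him)
  exact nonpos_of_mul_nonpos_left (hle.trans hsum) hpos

theorem inv_apply_nonpos_of_ne (hA : IsKaluzaMatrix A) {i j : ι} (h : i ≠ j) : A⁻¹ i j ≤ 0 := by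
  rcases lt_or_gt_of_ne h with h | h
  · exact hA.inv_apply_nonpos h
  · exact (hA.inv_apply_eq_zero h).le

/-- In A⁻¹A = 1, read off the last column L: entries A k L grow with k and the off-diagonal weights
are nonpositive, so replacing A k L by A i L only raises the sum. -/
theorem sum_row_inv_nonneg (hA : IsKaluzaMatrix A) (i : ι) : 0 ≤ ∑ k, A⁻¹ i k := by
  have hne : (Finset.univ : Finset ι).Nonempty := ⟨i, Finset.mem_univ i⟩
  set L := Finset.univ.max' hne
  have hL : ∀ k, k ≤ L := fun k => Finset.le_max' _ _ (Finset.mem_univ k)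
  have h1 : 0 ≤ ∑ k, A⁻¹ i k * A k L := by
    rw [hA.sum_inv_mul]; split_ifs <;> norm_num
  have h2 : ∑ k, A⁻¹ i k * A k L ≤ (∑ k, A⁻¹ i k) * A i L := by
    rw [Finset.sum_mul]
    refine Finset.sum_le_sum fun k _ => ?_
    rcases lt_trichotomy k i with hki | rfl | hki
    · rw [hA.inv_apply_eq_zero hki, zero_mul, zero_mul]
    · exact le_rfl
    · exact mul_le_mul_of_nonpos_left (hA.mono i k L hki.le (hL k)) (hA.inv_apply_nonpos hki)
  exact nonneg_of_mul_nonneg_left (h1.trans h2) (hA.pos i L (hL i))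

/-- The mirror argument, with AA⁻¹ = 1 and the first row, whose entries decrease. -/
theorem sum_col_inv_nonneg (hA : IsKaluzaMatrix A) (l : ι) : 0 ≤ ∑ k, A⁻¹ k l := by
  have hne : (Finset.univ : Finset ι).Nonempty := ⟨l, Finset.mem_univ l⟩
  set b := Finset.univ.min' hne
  have hb : ∀ k, b ≤ k := fun k => Finset.min'_le _ _ (Finset.mem_univ k)
  have h1 : 0 ≤ ∑ k, A b k * A⁻¹ k l := by
    rw [hA.sum_mul_inv]; split_ifs <;> norm_num
  have h2 : ∑ k, A b k * A⁻¹ k l ≤ A b l * ∑ k, A⁻¹ k l := by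
    rw [Finset.mul_sum]
    refine Finset.sum_le_sum fun k _ => ?_
    rcases lt_trichotomy k l with hkl | rfl | hkl
    · exact mul_le_mul_of_nonpos_right (hA.anti b k l (hb k) hkl.le) (hA.inv_apply_nonpos hkl)
    · exact le_rfl
    · rw [hA.inv_apply_eq_zero hkl, mul_zero, mul_zero]
  exact nonneg_of_mul_nonneg_right (h1.trans h2) (hA.pos b l (hb l))

/-- Only the diagonal entry can be positive, so the absolute sum is twice that entry minus the
nonnegative row sum; the diagonal entry is the reciprocal of A i i. -/
theorem sum_row_abs_inv_le (hA : IsKaluzaMatrix A) {δ : ℝ} (hδ : 0 < δ) (hd : ∀ i, δ ≤ A i i)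
    (i : ι) : ∑ k, |A⁻¹ i k| ≤ 2 / δ := by
  have h : ∑ k, |A⁻¹ i k| = 2 * A⁻¹ i i - ∑ k, A⁻¹ i k := by
    rw [← Finset.add_sum_erase _ _ (Finset.mem_univ i),
      ← Finset.add_sum_erase _ (fun k => A⁻¹ i k) (Finset.mem_univ i),
      Finset.sum_congr rfl fun k hk => abs_of_nonpos
        (hA.inv_apply_nonpos_of_ne (Finset.mem_erase.1 hk).1.symm), Finset.sum_neg_distrib,
      abs_of_nonneg (by rw [hA.inv_apply_self]; exact inv_nonneg.2 (hA.pos i i le_rfl).le)]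
    ring
  have h1 : A⁻¹ i i ≤ 1 / δ := by
    rw [hA.inv_apply_self, ← one_div]; exact one_div_le_one_div_of_le hδ (hd i)
  have := hA.sum_row_inv_nonneg i
  rw [h, show 2 / δ = 2 * (1 / δ) by ring]; linarith

theorem sum_col_abs_inv_le (hA : IsKaluzaMatrix A) {δ : ℝ} (hδ : 0 < δ) (hd : ∀ i, δ ≤ A i i)
    (i : ι) : ∑ k, |A⁻¹ k i| ≤ 2 / δ := by
  have h : ∑ k, |A⁻¹ k i| = 2 * A⁻¹ i i - ∑ k, A⁻¹ k i := by
    rw [← Finset.add_sum_erase _ _ (Finset.mem_univ i),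
      ← Finset.add_sum_erase _ (fun k => A⁻¹ k i) (Finset.mem_univ i),
      Finset.sum_congr rfl fun k hk => abs_of_nonpos
        (hA.inv_apply_nonpos_of_ne (Finset.mem_erase.1 hk).1), Finset.sum_neg_distrib,
      abs_of_nonneg (by rw [hA.inv_apply_self]; exact inv_nonneg.2 (hA.pos i i le_rfl).le)]
    ring
  have h1 : A⁻¹ i i ≤ 1 / δ := by
    rw [hA.inv_apply_self, ← one_div]; exact one_div_le_one_div_of_le hδ (hd i)
  have := hA.sum_col_inv_nonneg i
  rw [h, show 2 / δ = 2 * (1 / δ) by ring]; linarith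

/-- Schur test for A⁻¹, applied to c = A⁻¹(Ac). -/
theorem sum_sq_le (hA : IsKaluzaMatrix A) {δ : ℝ} (hδ : 0 < δ) (hd : ∀ i, δ ≤ A i i)
    (c : ι → ℂ) :
    ∑ j, ‖c j‖ₑ ^ 2 ≤ ENNReal.ofReal (2 / δ) ^ 2 * ∑ j, ‖∑ k, (A j k : ℂ) * c k‖ₑ ^ 2 := by
  have hN : ∀ j, c j = ∑ k, (A⁻¹ j k : ℂ) * ∑ l, (A k l : ℂ) * c l := by
    intro j
    simp_rw [Finset.mul_sum]
    rw [Finset.sum_comm]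
    simp_rw [← mul_assoc, ← Finset.sum_mul]
    have : ∀ l, ∑ k, (A⁻¹ j k : ℂ) * (A k l : ℂ) = if j = l then 1 else 0 := by
      intro l
      have := congrArg (fun x : ℝ => (x : ℂ)) (hA.sum_inv_mul j l)
      push_cast at this
      rw [this]
      split_ifs <;> simp
    simp [this]
  have e : ∀ x : ℝ, ‖x‖ₑ = ENNReal.ofReal |x| := fun x => by
    rw [← Real.norm_eq_abs, ofReal_norm]
  have := ENNReal.schur_test (fun j k => ‖A⁻¹ j k‖ₑ) (fun k => ‖∑ l, (A k l : ℂ) * c l‖ₑ)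
    (ENNReal.ofReal (2 / δ)) (ENNReal.ofReal (2 / δ))
    (fun j => by
      simp_rw [tsum_fintype, e]
      rw [← ENNReal.ofReal_sum_of_nonneg fun _ _ => abs_nonneg _]
      exact ENNReal.ofReal_le_ofReal (hA.sum_row_abs_inv_le hδ hd j))
    (fun j => by
      simp_rw [tsum_fintype, e]
      rw [← ENNReal.ofReal_sum_of_nonneg fun _ _ => abs_nonneg _]
      exact ENNReal.ofReal_le_ofReal (hA.sum_col_abs_inv_le hδ hd j))
  simp_rw [tsum_fintype] at this
  rw [sq (ENNReal.ofReal (2 / δ))]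
  refine le_trans (Finset.sum_le_sum fun j _ => ?_) this
  gcongr
  conv_lhs => rw [hN j]
  refine (enorm_sum_le _ _).trans (Finset.sum_le_sum fun k _ => ?_)
  rw [enorm_mul]
  gcongr
  rw [← ofReal_norm, ← ofReal_norm, Complex.norm_real]

end IsKaluzaMatrix

/-! ### Kaluza windows and their ℓ² bounds. -/

/-- A window on the half-line which is positive, decreasing, log-convex and exponentially
decaying. -/
structure IsKaluzaWindow (Φ : ℝ → ℝ) (b M : ℝ) : Prop where
  rate_pos : 0 < b
  eq_zero : ∀ x ≤ 0, Φ x = 0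
  pos : ∀ x, 0 < x → 0 < Φ x
  anti : ∀ x y, 0 < x → x ≤ y → Φ y ≤ Φ x
  log_convex : ∀ x s t, 0 < x → 0 ≤ s → 0 ≤ t → Φ (x + s) * Φ (x + t) ≤ Φ (x + s + t) * Φ x
  le_exp : ∀ x, 0 < x → Φ x ≤ M * Real.exp (-b * x)

namespace IsKaluzaWindow

variable {Φ : ℝ → ℝ} {b M : ℝ}

theorem const_nonneg (h : IsKaluzaWindow Φ b M) : 0 ≤ M := by
  have h1 := (h.pos 1 one_pos).le.trans (h.le_exp 1 one_pos)
  exact nonneg_of_mul_nonneg_left h1 (Real.exp_pos _)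

theorem nonneg (h : IsKaluzaWindow Φ b M) (x : ℝ) : 0 ≤ Φ x := by
  rcases le_or_gt x 0 with hx | hx
  · exact (h.eq_zero x hx).ge
  · exact (h.pos x hx).le

/-- Reindexing moves y into (0, p]; then terms with k < 0 vanish and the others lie under a
geometric series that does not depend on y. -/
theorem exists_tsum_le (h : IsKaluzaWindow Φ b M) {p : ℝ} (hp : 0 < p) :
    ∃ C : ℝ≥0∞, C ≠ ∞ ∧ ∀ y : ℝ, ∑' k : ℤ, ‖Φ (y + k * p)‖ₑ ≤ C := by
  have hs : Summable fun j : ℕ => M * Real.exp (-b * p) ^ j := by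
    refine (summable_geometric_of_lt_one (Real.exp_pos _).le ?_).mul_left M
    rw [Real.exp_lt_one_iff]
    nlinarith [h.rate_pos]
  refine ⟨∑' j : ℕ, ENNReal.ofReal (M * Real.exp (-b * p) ^ j), hs.tsum_ofReal_ne_top, fun y => ?_⟩
  obtain ⟨m, hm, -⟩ := existsUnique_add_zsmul_mem_Ioc hp y 0
  rw [zsmul_eq_mul, zero_add] at hm
  rw [← (Equiv.addLeft m).tsum_eq (fun k : ℤ => ‖Φ (y + k * p)‖ₑ)]
  have hx : ∀ k : ℤ, y + ((Equiv.addLeft m k : ℤ) : ℝ) * p = (y + m * p) + k * p := fun k => by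
    simp only [Equiv.coe_addLeft]; push_cast; ring
  simp_rw [hx]
  rw [← Function.Injective.tsum_eq (g := ((↑) : ℕ → ℤ)) Nat.cast_injective]
  · refine ENNReal.tsum_le_tsum fun j => ?_
    rw [← ofReal_norm, Real.norm_of_nonneg (h.nonneg _)]
    refine ENNReal.ofReal_le_ofReal ?_
    have hj : 0 ≤ (j : ℝ) * p := by positivity
    have hpos : 0 < y + m * p + ((j : ℤ) : ℝ) * p := by
      push_cast; linarith [hm.1]
    refine (h.le_exp _ hpos).trans (mul_le_mul_of_nonneg_left ?_ h.const_nonneg)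
    rw [← Real.exp_nat_mul]
    apply Real.exp_le_exp.2
    push_cast
    nlinarith [h.rate_pos, hm.1]
  · intro k hk
    rw [Function.mem_support] at hk
    by_contra hneg
    apply hk
    have hk0 : k < 0 := by
      by_contra h0
      exact hneg ⟨k.toNat, by simpa using Int.toNat_of_nonneg (not_lt.1 h0)⟩
    have hk1 : (k : ℝ) ≤ -1 := by exact_mod_cast Int.le_sub_one_of_lt hk0
    rw [h.eq_zero _ (by nlinarith [hm.2]), enorm_zero]

/-- Moving left from the diagonal lowers the argument by at least p ≥ β, which gives triangularity.
The row index n k decreases with k, hence `mono`. For `ratio`, log-convexity is based at entry (j,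
k), with one increment along the row and one between rows. -/
theorem isKaluzaMatrix (h : IsKaluzaWindow Φ b M) {p β : ℝ} (hβ : 0 < β) (hβp : β ≤ p) (y : ℝ)
    (n : ℤ → ℤ) (hn : ∀ k : ℤ, y + k * p + β * n k ∈ Set.Ioc 0 β) (s : Finset ℤ) :
    IsKaluzaMatrix (Matrix.of fun j k : s => Φ (y + (k : ℤ) * p + β * n j)) := by
  have hp : 0 < p := hβ.trans_le hβp
  have hk : ∀ i j : s, i ≤ j → ((i : ℤ) : ℝ) * p ≤ ((j : ℤ) : ℝ) * p := fun i j hij => by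
    have : ((i : ℤ) : ℝ) ≤ ((j : ℤ) : ℝ) := by exact_mod_cast hij
    gcongr
  have hk1 : ∀ i j : s, i < j → ((i : ℤ) : ℝ) * p + p ≤ ((j : ℤ) : ℝ) * p := fun i j hij => by
    have : ((i : ℤ) : ℝ) + 1 ≤ ((j : ℤ) : ℝ) := by exact_mod_cast hij
    nlinarith
  have hnn : ∀ i j : s, i ≤ j → β * n j ≤ β * n i := fun i j hij => by
    rcases hij.eq_or_lt with rfl | hij
    · exact le_rfl
    · linarith [(hn i).1, (hn j).2, hk1 i j hij]
  have hpos : ∀ i j : s, i ≤ j → 0 < y + (j : ℤ) * p + β * n i := fun i j hij => by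
    linarith [(hn i).1, hk i j hij]
  constructor
  · intro i j hij
    exact h.eq_zero _ (by linarith [(hn i).2, hk1 j i hij])
  · intro i j hij
    exact h.pos _ (hpos i j hij)
  · intro i j k hij hjk
    exact h.anti _ _ (hpos i j hij) (by linarith [hk j k hjk])
  · intro i j k hij hjk
    exact h.anti _ _ (hpos j k hjk) (by linarith [hnn i j hij])
  · intro i j k l hij hjk hkl
    have := h.log_convex _ (((l : ℤ) : ℝ) * p - (k : ℤ) * p) (β * n i - β * n j) (hpos j k hjk)
      (by linarith [hk k l hkl]) (by linarith [hnn i j hij])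
    simp only [Matrix.of_apply]
    convert this using 3 <;> ring_nf

/-- Upper bound for the rows-by-columns action of a shifted window on sequences. -/
theorem exists_tsum_sq_le (h : IsKaluzaWindow Φ b M) {p β : ℝ} (hβ : 0 < β) (hp : 0 < p) :
    ∃ B : ℝ≥0∞, B ≠ ∞ ∧ ∀ (y : ℝ) (f : ℤ → ℝ≥0∞),
      ∑' n : ℤ, (∑' k : ℤ, ‖Φ (y + k * p + β * n)‖ₑ * f k) ^ 2 ≤ B * ∑' k, f k ^ 2 := by
  obtain ⟨C, hC, hC'⟩ := h.exists_tsum_le hp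
  obtain ⟨D, hD, hD'⟩ := h.exists_tsum_le hβ
  refine ⟨C * D, ENNReal.mul_ne_top hC hD, fun y f => ?_⟩
  refine ENNReal.schur_test _ f C D (fun n => ?_) (fun k => ?_)
  · convert hC' (y + β * n) using 5; ring
  · convert hD' (y + k * p) using 5; ring

theorem summable_mul (h : IsKaluzaWindow Φ b M) {p β : ℝ} (hβ : 0 < β) (hp : 0 < p)
    (y : ℝ) {c : ℤ → ℂ} (hc : ∑' k, ‖c k‖ₑ ^ 2 ≠ ∞) (n : ℤ) :
    Summable fun k : ℤ => (Φ (y + k * p + β * n) : ℂ) * c k := by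
  obtain ⟨B, hB, hB'⟩ := h.exists_tsum_sq_le hβ hp
  have h1 := ne_top_of_le_ne_top (ENNReal.mul_ne_top hB hc) (hB' y fun k => ‖c k‖ₑ)
  have h2 := ne_top_of_le_ne_top h1 (ENNReal.le_tsum n)
  have h3 : ∑' k : ℤ, ‖(Φ (y + k * p + β * n) : ℂ) * c k‖ₑ ≠ ∞ := by
    simp_rw [enorm_mul]
    intro h4
    apply h2
    simp_rw [← ofReal_norm, Complex.norm_real] at h4 ⊢
    rw [h4]; simp
  exact Summable.of_nnnorm (tsum_enorm_ne_top_iff_summable_nnnorm.1 h3)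

theorem exists_tsum_enorm_sq_le (h : IsKaluzaWindow Φ b M) {p β : ℝ} (hβ : 0 < β) (hp : 0 < p) :
    ∃ B : ℝ≥0∞, B ≠ ∞ ∧ ∀ (y : ℝ) (c : ℤ → ℂ),
      ∑' n : ℤ, ‖∑' k : ℤ, (Φ (y + k * p + β * n) : ℂ) * c k‖ₑ ^ 2 ≤ B * ∑' k, ‖c k‖ₑ ^ 2 := by
  obtain ⟨B, hB, hB'⟩ := h.exists_tsum_sq_le hβ hp
  refine ⟨B, hB, fun y c => le_trans (ENNReal.tsum_le_tsum fun n => ?_) (hB' y fun k => ‖c k‖ₑ)⟩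
  gcongr
  refine enorm_tsum_le_tsum_enorm.trans (ENNReal.tsum_le_tsum fun k => ?_)
  rw [enorm_mul]
  simp_rw [← ofReal_norm, Complex.norm_real]
  exact le_rfl

/-- Lower bound for the rows-by-columns action of a shifted window on sequences. -/
theorem exists_le_tsum_enorm_sq (h : IsKaluzaWindow Φ b M) {p β : ℝ} (hβ : 0 < β) (hβp : β ≤ p) :
    ∃ C : ℝ≥0∞, C ≠ ∞ ∧ ∀ (y : ℝ) (c : ℤ → ℂ), ∑' k, ‖c k‖ₑ ^ 2 ≠ ∞ →
      ∑' k, ‖c k‖ₑ ^ 2 ≤ C * ∑' n : ℤ, ‖∑' k : ℤ, (Φ (y + k * p + β * n) : ℂ) * c k‖ₑ ^ 2 := by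
  have hp : 0 < p := hβ.trans_le hβp
  obtain ⟨B, hB, hB'⟩ := h.exists_tsum_enorm_sq_le hβ hp
  set D : ℝ≥0∞ := ENNReal.ofReal (2 / Φ β) ^ 2 with hD
  have hDtop : D ≠ ∞ := by simp [hD]
  -- D bounds the squared norm of the inverse sections, whose diagonals are at least Φ β. The 2
  -- comes from |u - v|² ≤ 2|u|² + 2|v|².
  refine ⟨D * 2, ENNReal.mul_ne_top hDtop (by norm_num), fun y c hc => ?_⟩
  have hex : ∀ k : ℤ, ∃ m : ℤ, y + k * p + β * m ∈ Set.Ioc 0 β := fun k => by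
    obtain ⟨m, hm, -⟩ := existsUnique_add_zsmul_mem_Ioc hβ (y + k * p) 0
    exact ⟨m, by rw [zsmul_eq_mul, zero_add, mul_comm (m : ℝ)] at hm; exact hm⟩
  choose n hn using hex
  have hinj : Function.Injective n := by
    intro i j hij
    by_contra hne
    wlog hlt : i < j generalizing i j
    · exact this hij.symm (Ne.symm hne) (lt_of_le_of_ne (not_lt.1 hlt) (Ne.symm hne))
    have h1 : (i : ℝ) + 1 ≤ j := by exact_mod_cast hlt
    have h2 := (hn i).1
    have h3 := (hn j).2
    rw [← hij] at h3
    nlinarith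
  set S := ∑' n : ℤ, ‖∑' k : ℤ, (Φ (y + k * p + β * n) : ℂ) * c k‖ₑ ^ 2
  have hsum := fun m => h.summable_mul hβ hp y hc m
  -- A section sees only the columns in s: it is the full row sum minus the contribution of the tail
  -- d, which the upper bound controls.
  have hfin : ∀ s : Finset ℤ, ∑ k ∈ s, ‖c k‖ₑ ^ 2
      ≤ D * (2 * S + 2 * (B * ∑' k : {k // k ∉ s}, ‖c k‖ₑ ^ 2)) := by
    intro s
    have h1 := (h.isKaluzaMatrix hβ hβp y n hn s).sum_sq_le (h.pos β hβ)
      (fun i => h.anti _ _ (hn i).1 (hn i).2) (fun k => c k)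
    rw [Finset.sum_coe_sort s (fun k => ‖c k‖ₑ ^ 2)] at h1
    refine h1.trans (mul_le_mul_right ?_ D)
    simp only [Matrix.of_apply]
    set d : ℤ → ℂ := fun k => if k ∈ s then 0 else c k with hd
    have h2 : ∀ m : ℤ, ∑ k : s, (Φ (y + (k : ℤ) * p + β * m) : ℂ) * c k
        = ∑' k : ℤ, (Φ (y + k * p + β * m) : ℂ) * c k
          - ∑' k : ℤ, (Φ (y + k * p + β * m) : ℂ) * d k := by
      intro m
      rw [Finset.sum_coe_sort s (fun k : ℤ => (Φ (y + k * p + β * m) : ℂ) * c k),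
        ← (hsum m).sum_add_tsum_subtype_compl s]
      have : ∑' k : ℤ, (Φ (y + k * p + β * m) : ℂ) * d k
          = ∑' k : {k // k ∉ s}, (Φ (y + (k : ℤ) * p + β * m) : ℂ) * c k := by
        rw [show (∑' k : {k // k ∉ s}, (Φ (y + (k : ℤ) * p + β * m) : ℂ) * c k)
          = ∑' k : {k | k ∉ s}, (Φ (y + ((k : ℤ) : ℝ) * p + β * m) : ℂ) * c k from rfl,
          tsum_subtype {k : ℤ | k ∉ s} (fun k : ℤ => (Φ (y + k * p + β * m) : ℂ) * c k)]
        refine tsum_congr fun k => ?_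
        by_cases hks : k ∈ s <;> simp [hd, hks]
      rw [this]; ring
    have h3 : ∑' k, ‖d k‖ₑ ^ 2 = ∑' k : {k // k ∉ s}, ‖c k‖ₑ ^ 2 := by
      rw [show (∑' k : {k // k ∉ s}, ‖c k‖ₑ ^ 2) = ∑' k : {k | k ∉ s}, ‖c k‖ₑ ^ 2 from rfl,
        tsum_subtype {k : ℤ | k ∉ s} (fun k => ‖c k‖ₑ ^ 2)]
      refine tsum_congr fun k => ?_
      by_cases hks : k ∈ s <;> simp [hd, hks]
    have h4 : ∀ u v : ℂ, ‖u - v‖ₑ ^ 2 ≤ 2 * ‖u‖ₑ ^ 2 + 2 * ‖v‖ₑ ^ 2 := fun u v => by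
      have h5 : ‖u - v‖ ^ 2 ≤ 2 * ‖u‖ ^ 2 + 2 * ‖v‖ ^ 2 := by
        nlinarith [norm_sub_le u v, norm_nonneg (u - v), sq_nonneg (‖u‖ - ‖v‖)]
      have h6 := ENNReal.ofReal_le_ofReal h5
      rw [ENNReal.ofReal_add (by positivity) (by positivity),
        ENNReal.ofReal_mul (by norm_num), ENNReal.ofReal_mul (by norm_num),
        ENNReal.ofReal_pow (norm_nonneg _), ENNReal.ofReal_pow (norm_nonneg _),
        ENNReal.ofReal_pow (norm_nonneg _)] at h6
      simpa [ofReal_norm] using h6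
    calc ∑ j : s, ‖∑ k : s, (Φ (y + (k : ℤ) * p + β * n j) : ℂ) * c k‖ₑ ^ 2
        = ∑ j ∈ s, ‖∑ k : s, (Φ (y + (k : ℤ) * p + β * n j) : ℂ) * c k‖ₑ ^ 2 :=
          Finset.sum_coe_sort s
            (fun j => ‖∑ k : s, (Φ (y + (k : ℤ) * p + β * n j) : ℂ) * c k‖ₑ ^ 2)
      _ ≤ ∑' j : ℤ, ‖∑ k : s, (Φ (y + (k : ℤ) * p + β * n j) : ℂ) * c k‖ₑ ^ 2 :=
          ENNReal.sum_le_tsum s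
      _ ≤ ∑' m : ℤ, ‖∑ k : s, (Φ (y + (k : ℤ) * p + β * m) : ℂ) * c k‖ₑ ^ 2 :=
          ENNReal.tsum_comp_le_tsum_of_injective hinj
            (fun m : ℤ => ‖∑ k : s, (Φ (y + (k : ℤ) * p + β * m) : ℂ) * c k‖ₑ ^ 2)
      _ ≤ ∑' m : ℤ, (2 * ‖∑' k : ℤ, (Φ (y + k * p + β * m) : ℂ) * c k‖ₑ ^ 2
            + 2 * ‖∑' k : ℤ, (Φ (y + k * p + β * m) : ℂ) * d k‖ₑ ^ 2) := by
          refine ENNReal.tsum_le_tsum fun m => ?_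
          rw [h2 m]; exact h4 _ _
      _ ≤ 2 * S + 2 * (B * ∑' k : {k // k ∉ s}, ‖c k‖ₑ ^ 2) := by
          rw [ENNReal.tsum_add, ENNReal.tsum_mul_left, ENNReal.tsum_mul_left, ← h3]
          gcongr
          exact hB' y d
  have hlim : Tendsto (fun s : Finset ℤ => D * (2 * S + 2 * (B * ∑' k : {k // k ∉ s}, ‖c k‖ₑ ^ 2)))
      atTop (𝓝 (D * (2 * S + 2 * (B * 0)))) := by
    refine ENNReal.Tendsto.const_mul (tendsto_const_nhds.add ?_) (Or.inr hDtop)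
    refine ENNReal.Tendsto.const_mul ?_ (Or.inr (by norm_num))
    exact ENNReal.Tendsto.const_mul (ENNReal.tendsto_tsum_compl_atTop_zero hc) (Or.inr hB)
  have := le_of_tendsto_of_tendsto' (ENNReal.summable.hasSum) hlim hfin
  simpa [mul_assoc] using this

end IsKaluzaWindow

/-! ### Fourier transform and time-frequency shifts. -/

/-- On `L¹ ∩ L²` the `L²`-Fourier transform is given by the Fourier integral. -/
theorem coeFn_fourier_toLp {u : ℝ → ℂ} (h1 : Integrable u) (h2 : MemLp u 2 volume) :
    ((𝓕 (h2.toLp u) : Lp ℂ 2 (volume : Measure ℝ)) : ℝ → ℂ) =ᵐ[volume] 𝓕 u := by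
  have hcont : Continuous (𝓕 u) := by
    exact VectorFourier.fourierIntegral_continuous Real.continuous_fourierChar
      (by exact continuous_inner) h1
  refine ae_eq_of_integral_contDiff_smul_eq ((Lp.memLp _).locallyIntegrable (by norm_num))
    hcont.locallyIntegrable fun g hg hgc => ?_
  have hg' : ContDiff ℝ ((⊤ : ℕ∞) : WithTop ℕ∞) (fun x => (g x : ℂ)) :=
    Complex.ofRealCLM.contDiff.comp hg
  have hgc' : HasCompactSupport (fun x => (g x : ℂ)) := hgc.comp_left Complex.ofReal_zero
  set G : SchwartzMap ℝ ℂ := hgc'.toSchwartzMap hg' with hG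
  have hGx : ∀ x, G x = (g x : ℂ) := fun x => rfl
  -- Both transforms satisfy the same multiplication formula against test functions: the L² one
  -- through tempered distributions, the integral one through Fubini (`e3`).
  have e1 : ∫ x, G x • (𝓕 (h2.toLp u) : Lp ℂ 2 (volume : Measure ℝ)) x
      = ∫ x, (𝓕 G) x • (h2.toLp u) x := by
    have := congrArg (fun T => T G) (Lp.fourier_toTemperedDistribution_eq (h2.toLp u))
    simp only [TemperedDistribution.fourier_apply, Lp.toTemperedDistribution_apply] at this
    exact this.symm
  have e2 : ∫ x, (𝓕 G) x • (h2.toLp u) x = ∫ x, (𝓕 (G : ℝ → ℂ)) x • u x := by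
    refine integral_congr_ae ?_
    filter_upwards [h2.coeFn_toLp] with x hx
    rw [hx, SchwartzMap.fourier_coe]
  have e3 : ∫ x, (𝓕 (G : ℝ → ℂ)) x • u x = ∫ x, G x • (𝓕 u) x := by
    simpa using! (VectorFourier.integral_fourierIntegral_smul_eq_flip (L := innerₗ ℝ)
      (μ := volume) (ν := volume) Real.continuous_fourierChar continuous_inner G.integrable h1)
  have e4 := (e1.trans e2).trans e3
  simpa only [hGx, smul_eq_mul, Complex.real_smul] using e4

theorem memLp_fourier {u : ℝ → ℂ} (h1 : Integrable u) (h2 : MemLp u 2 volume) :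
    MemLp (𝓕 u) 2 volume :=
  (memLp_congr_ae (coeFn_fourier_toLp h1 h2)).1 (Lp.memLp _)

theorem toLp_fourier_eq {u : ℝ → ℂ} (h1 : Integrable u) (h2 : MemLp u 2 volume)
    (h : MemLp (𝓕 u) 2 volume) : h.toLp (𝓕 u) = 𝓕 (h2.toLp u) := by
  refine Lp.ext (h.coeFn_toLp.trans (coeFn_fourier_toLp h1 h2).symm)

theorem norm_timeFreqShift (t ω : ℝ) (g : ℝ → ℂ) (x : ℝ) :
    ‖timeFreqShift t ω g x‖ = ‖g (x - t)‖ := by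
  have h2 : (2 * Real.pi * Complex.I * ω * x : ℂ)
      = ((2 * Real.pi * ω * x : ℝ) : ℂ) * Complex.I := by push_cast; ring
  rw [timeFreqShift, norm_mul, h2, Complex.norm_exp_ofReal_mul_I, one_mul]

theorem integrable_timeFreqShift (t ω : ℝ) {g : ℝ → ℂ} (hg : Integrable g) :
    Integrable (timeFreqShift t ω g) := by
  have h1 : Integrable (fun x => g (x - t)) := hg.comp_sub_right t
  have hc : Continuous fun x : ℝ =>
      Complex.exp (2 * Real.pi * Complex.I * ω * (x : ℂ)) := by fun_prop
  exact h1.mono (hc.aestronglyMeasurable.mul h1.aestronglyMeasurable)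
    (Filter.Eventually.of_forall fun x => (norm_timeFreqShift t ω g x).le)

/-- The Fourier transform intertwines time-frequency shifts, up to a phase. -/
theorem timeFreqShift_fourier (t ω : ℝ) (u : ℝ → ℂ) :
    timeFreqShift t ω (𝓕 u)
      = 𝓕 (Complex.exp (2 * Real.pi * Complex.I * t * ω) • timeFreqShift (-ω) t u) := by
  ext x
  rw [timeFreqShift, Real.fourier_real_eq_integral_exp_smul,
    Real.fourier_real_eq_integral_exp_smul,
    ← integral_add_right_eq_self (fun v : ℝ => Complex.exp (_ : ℂ) • u v) ω,
    ← integral_const_mul]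
  refine integral_congr_ae (Filter.Eventually.of_forall fun v => ?_)
  simp only [smul_eq_mul, timeFreqShift, Pi.smul_apply, sub_neg_eq_add, ← mul_assoc,
    ← Complex.exp_add]
  congr 2
  push_cast
  ring

/-- Plancherel, together with the unimodularity of the phase c; the translation and modulation
lattices exchange roles. -/
theorem norm_inner_gaborSystem_fourier {u : ℝ → ℂ} (h1 : Integrable u) (h2 : MemLp u 2 volume)
    (hg : MemLp (𝓕 u) 2 volume) (α β : ℝ) (i : ℤ × ℤ) (h : Lp ℂ 2 (volume : Measure ℝ)) :
    ‖inner ℂ (gaborSystem (𝓕 u) hg α β i) (𝓕 h)‖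
      = ‖inner ℂ ((memLp_timeFreqShift (-(β * i.2)) (α * i.1) h2).toLp) h‖ := by
  set c := Complex.exp (2 * Real.pi * Complex.I * (α * i.1 : ℝ) * (β * i.2 : ℝ)) with hc
  have hcn : ‖c‖ = 1 := by
    rw [hc, show (2 * Real.pi * Complex.I * (α * i.1 : ℝ) * (β * i.2 : ℝ) : ℂ)
      = ((2 * Real.pi * (α * i.1) * (β * i.2) : ℝ) : ℂ) * Complex.I by push_cast; ring,
      Complex.norm_exp_ofReal_mul_I]
  have hv1 := (integrable_timeFreqShift (-(β * i.2)) (α * i.1) h1).smul c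
  have hv2 := (memLp_timeFreqShift (-(β * i.2)) (α * i.1) h2)
  have hE := timeFreqShift_fourier (α * i.1) (β * i.2) u
  have hm := memLp_fourier hv1 (hv2.const_smul c)
  have : gaborSystem (𝓕 u) hg α β i = 𝓕 (c • hv2.toLp) := by
    rw [← MemLp.toLp_const_smul, ← toLp_fourier_eq hv1 (hv2.const_smul c) hm, gaborSystem]
    exact MemLp.toLp_congr _ _ (Filter.Eventually.of_forall fun x => congrFun hE x)
  rw [this, Lp.inner_fourier_eq, inner_smul_left, norm_mul, RCLike.norm_conj, hcn, one_mul]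

/-! ### Periodization and Parseval. -/

theorem lintegral_eq_lintegral_tsum_add_mul {f : ℝ → ℝ≥0∞} (hf : AEMeasurable f) {p : ℝ}
    (hp : 0 < p) : ∫⁻ x, f x = ∫⁻ x in Set.Ioc 0 p, ∑' k : ℤ, f (x + k * p) := by
  have hm : ∀ k : ℤ, AEMeasurable (fun x => f (x + k * p)) (volume.restrict (Set.Ioc 0 p)) :=
    fun k => (hf.comp_quasiMeasurePreserving
      (measurePreserving_add_right volume ((k : ℝ) * p)).quasiMeasurePreserving).restrict
  rw [lintegral_tsum hm, ← setLIntegral_univ, ← iUnion_Ioc_add_zsmul hp 0,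
    lintegral_iUnion (fun _ => measurableSet_Ioc) (Set.pairwise_disjoint_Ioc_add_zsmul 0 p)]
  refine tsum_congr fun k => ?_
  have hs : (fun x : ℝ => x + k * p) ⁻¹' Set.Ioc (0 + k • p) (0 + (k + 1) • p) = Set.Ioc 0 p := by
    rw [Set.preimage_add_const_Ioc]; simp [add_mul]
  rw [← hs]
  exact ((measurePreserving_add_right volume ((k : ℝ) * p)).setLIntegral_comp_preimage_emb
    (measurableEmbedding_addRight _) f _).symm

theorem integral_eq_integral_tsum_add_mul {f : ℝ → ℂ} (hf : Integrable f) {p : ℝ}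
    (hp : 0 < p) : ∫ x, f x = ∫ x in Set.Ioc 0 p, ∑' k : ℤ, f (x + k * p) := by
  have hm : ∀ k : ℤ, AEStronglyMeasurable (fun x => f (x + k * p))
      (volume.restrict (Set.Ioc 0 p)) :=
    fun k => (hf.aestronglyMeasurable.comp_quasiMeasurePreserving
      (measurePreserving_add_right volume ((k : ℝ) * p)).quasiMeasurePreserving).restrict
  have hfin : ∑' k : ℤ, ∫⁻ x in Set.Ioc 0 p, ‖f (x + k * p)‖ₑ ≠ ∞ := by
    rw [← lintegral_tsum fun k => (hm k).enorm,
      ← lintegral_eq_lintegral_tsum_add_mul hf.aestronglyMeasurable.enorm hp]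
    exact hf.hasFiniteIntegral.ne
  rw [integral_tsum hm hfin, ← setIntegral_univ, ← iUnion_Ioc_add_zsmul hp 0,
    integral_iUnion (fun _ => measurableSet_Ioc) (Set.pairwise_disjoint_Ioc_add_zsmul 0 p)
      hf.integrableOn]
  refine tsum_congr fun k => ?_
  have hs : (fun x : ℝ => x + k * p) ⁻¹' Set.Ioc (0 + k • p) (0 + (k + 1) • p) = Set.Ioc 0 p := by
    rw [Set.preimage_add_const_Ioc]; simp [add_mul]
  rw [← hs]
  exact ((measurePreserving_add_right volume ((k : ℝ) * p)).setIntegral_preimage_emb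
    (measurableEmbedding_addRight _) f _).symm

/-- Parseval's identity for the periodization of an integrable function. -/
theorem tsum_enorm_sq_integral_exp_mul {f : ℝ → ℂ} (hf : Integrable f) {p : ℝ} (hp : 0 < p)
    (hfin : ∫⁻ x in Set.Ioc 0 p, ‖∑' k : ℤ, f (x + k * p)‖ₑ ^ 2 ≠ ∞) :
    ∑' m : ℤ, ‖∫ x : ℝ, Complex.exp (-(2 * Real.pi * Complex.I * m * x / p)) * f x‖ₑ ^ 2
      = ENNReal.ofReal p * ∫⁻ x in Set.Ioc 0 p, ‖∑' k : ℤ, f (x + k * p)‖ₑ ^ 2 := by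
  set P : ℝ → ℂ := fun x => ∑' k : ℤ, f (x + k * p) with hP
  have hp0 : (p : ℂ) ≠ 0 := by exact_mod_cast hp.ne'
  have hPm : AEStronglyMeasurable P (volume.restrict (Set.Ioc 0 p)) :=
    (AEMeasurable.tsum fun k : ℤ => ((hf.aestronglyMeasurable.comp_quasiMeasurePreserving
      (measurePreserving_add_right volume ((k : ℝ) * p)).quasiMeasurePreserving).restrict
        ).aemeasurable).aestronglyMeasurable
  have hP2 : MemLp P 2 (volume.restrict (Set.Ioc 0 p)) := by
    refine ⟨hPm, ?_⟩
    rw [eLpNorm_lt_top_iff_lintegral_rpow_enorm_lt_top (by norm_num) (by norm_num)]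
    simpa using hfin.lt_top
  have hcoef : ∀ m : ℤ, ∫ x : ℝ, Complex.exp (-(2 * Real.pi * Complex.I * m * x / p)) * f x
      = p * fourierCoeffOn hp P m := by
    intro m
    have hc : Continuous fun x : ℝ =>
        Complex.exp (-(2 * Real.pi * Complex.I * m * (x : ℂ) / p)) := by fun_prop
    have hn : ∀ x : ℝ, ‖Complex.exp (-(2 * Real.pi * Complex.I * m * (x : ℂ) / p))‖ = 1 := by
      intro x
      rw [show -(2 * Real.pi * Complex.I * m * (x : ℂ) / p)
        = ((-(2 * Real.pi * m * x / p) : ℝ) : ℂ) * Complex.I by push_cast; ring,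
        Complex.norm_exp_ofReal_mul_I]
    have hint : Integrable fun x : ℝ =>
        Complex.exp (-(2 * Real.pi * Complex.I * m * (x : ℂ) / p)) * f x :=
      hf.mono (hc.aestronglyMeasurable.mul hf.aestronglyMeasurable)
        (Eventually.of_forall fun x => by rw [norm_mul, hn, one_mul])
    rw [integral_eq_integral_tsum_add_mul hint hp, fourierCoeffOn_eq_integral,
      intervalIntegral.integral_of_le hp.le, Complex.real_smul, ← mul_assoc]
    rw [show (p : ℂ) * ((1 / (p - 0) : ℝ) : ℂ) = 1 by push_cast; rw [sub_zero]; field_simp, one_mul]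
    refine integral_congr_ae (Eventually.of_forall fun x => ?_)
    simp only [smul_eq_mul]
    rw [hP, ← tsum_mul_left]
    refine tsum_congr fun k => ?_
    congr 1
    rw [fourier_coe_apply, Complex.exp_eq_exp_iff_exists_int]
    -- Shifting x by kp changes the exponent by -2πi·mk.
    refine ⟨-(m * k), ?_⟩
    push_cast
    rw [sub_zero]
    field_simp
    ring
  have hpars := hasSum_sq_fourierCoeffOn hp hP2
  have e1 : ∀ m : ℤ, ‖∫ x : ℝ, Complex.exp (-(2 * Real.pi * Complex.I * m * x / p)) * f x‖ₑ ^ 2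
      = ENNReal.ofReal (p ^ 2) * ENNReal.ofReal (‖fourierCoeffOn hp P m‖ ^ 2) := by
    intro m
    rw [hcoef, ← ofReal_norm, norm_mul, Complex.norm_real, Real.norm_of_nonneg hp.le,
      ← ENNReal.ofReal_pow (by positivity), mul_pow, ENNReal.ofReal_mul (by positivity)]
  simp_rw [e1]
  rw [ENNReal.tsum_mul_left, ← ENNReal.ofReal_tsum_of_nonneg (fun _ => by positivity)
    hpars.summable, hpars.tsum_eq, ← ENNReal.ofReal_mul (by positivity),
    intervalIntegral.integral_of_le hp.le]
  have e2 : ∫⁻ x in Set.Ioc 0 p, ‖P x‖ₑ ^ 2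
      = ENNReal.ofReal (∫ x in Set.Ioc 0 p, ‖P x‖ ^ 2) := by
    rw [ofReal_integral_eq_lintegral_ofReal hP2.integrable_norm_pow'
      (Eventually.of_forall fun _ => by positivity)]
    refine lintegral_congr fun x => ?_
    rw [ENNReal.ofReal_pow (norm_nonneg _), ofReal_norm]
  rw [e2, ← ENNReal.ofReal_mul hp.le, smul_eq_mul, sub_zero]
  congr 1
  field_simp

/-! ### From ℓ² bounds to Gabor frames. -/

/-- Frame bounds may be checked in the extended nonnegative reals. -/
theorem IsHilbertFrame.of_enorm {ι H : Type*} [NormedAddCommGroup H] [InnerProductSpace ℂ H]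
    {f : ι → H} {K C B : ℝ≥0∞} (hK0 : K ≠ 0) (hK : K ≠ ∞) (hC : C ≠ ∞) (hB : B ≠ ∞)
    (hlow : ∀ h : H, K * ‖h‖ₑ ^ 2 ≤ C * ∑' i, ‖inner ℂ (f i) h‖ₑ ^ 2)
    (hup : ∀ h : H, ∑' i, ‖inner ℂ (f i) h‖ₑ ^ 2 ≤ B * ‖h‖ₑ ^ 2) :
    IsHilbertFrame f := by
  have hKpos : 0 < K.toReal := ENNReal.toReal_pos hK0 hK
  -- Adding 1 keeps the constants positive even if C or B is zero.
  refine ⟨K.toReal / (C.toReal + 1), B.toReal + 1, by positivity, by positivity, fun h => ?_⟩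
  have hh : ‖h‖ₑ ^ 2 ≠ ∞ := by simp
  have hS : ∑' i, ‖inner ℂ (f i) h‖ₑ ^ 2 ≠ ∞ :=
    ne_top_of_le_ne_top (ENNReal.mul_ne_top hB hh) (hup h)
  have hterm : ∀ i, (‖inner ℂ (f i) h‖ₑ ^ 2).toReal = ‖inner ℂ (f i) h‖ ^ 2 := fun i => by
    rw [ENNReal.toReal_pow, toReal_enorm]
  have hsum : Summable fun i => ‖inner ℂ (f i) h‖ ^ 2 := by
    simpa only [hterm] using ENNReal.summable_toReal hS
  have htsum : (∑' i, ‖inner ℂ (f i) h‖ₑ ^ 2).toReal = ∑' i, ‖inner ℂ (f i) h‖ ^ 2 := by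
    rw [ENNReal.tsum_toReal_eq fun i => by simp]
    exact tsum_congr hterm
  have h1 := ENNReal.toReal_mono (ENNReal.mul_ne_top hC hS) (hlow h)
  have h2 := ENNReal.toReal_mono (ENNReal.mul_ne_top hB hh) (hup h)
  rw [ENNReal.toReal_mul, ENNReal.toReal_mul, htsum, ENNReal.toReal_pow, toReal_enorm] at h1
  rw [ENNReal.toReal_mul, htsum, ENNReal.toReal_pow, toReal_enorm] at h2
  have h3 : 0 ≤ ∑' i, ‖inner ℂ (f i) h‖ ^ 2 := tsum_nonneg fun i => by positivity
  refine ⟨hsum, ?_, h2.trans (by nlinarith [sq_nonneg ‖h‖])⟩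
  rw [div_mul_eq_mul_div, div_le_iff₀ (by positivity)]
  nlinarith

namespace IsKaluzaWindow

variable {Φ : ℝ → ℝ} {b M : ℝ}

theorem eq_indicator (h : IsKaluzaWindow Φ b M) : (Set.Ioi 0).indicator Φ = Φ := by
  ext x
  by_cases hx : x ∈ Set.Ioi (0 : ℝ)
  · rw [Set.indicator_of_mem hx]
  · rw [Set.indicator_of_notMem hx, h.eq_zero x (not_lt.1 hx)]

theorem aemeasurable (h : IsKaluzaWindow Φ b M) : AEMeasurable Φ := by
  rw [← h.eq_indicator, aemeasurable_indicator_iff measurableSet_Ioi]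
  exact aemeasurable_restrict_of_antitoneOn measurableSet_Ioi
    fun x hx y _ hxy => h.anti x y hx hxy

theorem integrable (h : IsKaluzaWindow Φ b M) : Integrable Φ := by
  rw [← h.eq_indicator, integrable_indicator_iff measurableSet_Ioi]
  refine ((exp_neg_integrableOn_Ioi 0 h.rate_pos).const_mul M).mono'
    h.aemeasurable.aestronglyMeasurable.restrict ?_
  filter_upwards [ae_restrict_mem measurableSet_Ioi] with x hx
  rw [Real.norm_of_nonneg (h.nonneg x)]
  exact h.le_exp x hx

theorem le_const (h : IsKaluzaWindow Φ b M) (x : ℝ) : Φ x ≤ M := by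
  rcases le_or_gt x 0 with hx | hx
  · rw [h.eq_zero x hx]; exact h.const_nonneg
  · refine (h.le_exp x hx).trans (mul_le_of_le_one_right h.const_nonneg ?_)
    rw [Real.exp_le_one_iff]
    nlinarith [h.rate_pos]

theorem memLp_two (h : IsKaluzaWindow Φ b M) : MemLp Φ 2 volume := by
  rw [memLp_two_iff_integrable_sq_norm h.aemeasurable.aestronglyMeasurable]
  refine (h.integrable.const_mul M).mono'
    (h.aemeasurable.aestronglyMeasurable.norm.pow 2) (Eventually.of_forall fun x => ?_)
  rw [norm_pow, norm_norm, Real.norm_of_nonneg (h.nonneg x), sq]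
  exact mul_le_mul_of_nonneg_right (h.le_const x) (h.nonneg x)

/-- For fixed n the inner products are, up to the conjugate of c, Fourier integrals of Φ(· + βn)H at
frequencies αm; Parseval for the 1/α-periodization sums them over m. -/
theorem tsum_inner_sq (h : IsKaluzaWindow Φ b M) {α β : ℝ} (hα : 0 < α) (hβ : 0 < β) (c : ℂ)
    (hu : MemLp (fun x => c * (Φ x : ℂ)) 2 volume) (H : Lp ℂ 2 (volume : Measure ℝ)) :
    ∑' i : ℤ × ℤ, ‖inner ℂ ((memLp_timeFreqShift (-(β * i.2)) (α * i.1) hu).toLp) H‖ₑ ^ 2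
      = ‖c‖ₑ ^ 2 * ENNReal.ofReal α⁻¹ * ∫⁻ x in Set.Ioc 0 α⁻¹,
        ∑' n : ℤ, ‖∑' k : ℤ, (Φ (x + k * α⁻¹ + β * n) : ℂ) * H (x + k * α⁻¹)‖ₑ ^ 2 := by
  have hp : 0 < α⁻¹ := inv_pos.2 hα
  have hHm : AEStronglyMeasurable H volume := Lp.aestronglyMeasurable H
  have hΦn : ∀ n : ℤ, MemLp (fun x => (Φ (x + β * n) : ℂ)) 2 volume := fun n =>
    (h.memLp_two.comp_measurePreserving (measurePreserving_add_right volume (β * n))).ofReal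
  have hF : ∀ n : ℤ, Integrable fun x => (Φ (x + β * n) : ℂ) * H x := fun n =>
    (hΦn n).integrable_mul (Lp.memLp H)
  have hPm : ∀ n : ℤ, AEMeasurable (fun x =>
      ‖∑' k : ℤ, (Φ (x + k * α⁻¹ + β * n) : ℂ) * H (x + k * α⁻¹)‖ₑ ^ 2)
      (volume.restrict (Set.Ioc 0 α⁻¹)) := fun n =>
    ((AEMeasurable.tsum fun k : ℤ => (((hF n).aestronglyMeasurable.comp_quasiMeasurePreserving
      (measurePreserving_add_right volume ((k : ℝ) * α⁻¹)).quasiMeasurePreserving).restrict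
        ).aemeasurable).enorm).pow_const 2
  obtain ⟨B, hB, hB'⟩ := h.exists_tsum_enorm_sq_le hβ hp
  have hHfin : ∫⁻ x in Set.Ioc 0 α⁻¹, ∑' k : ℤ, ‖H (x + k * α⁻¹)‖ₑ ^ 2 ≠ ∞ := by
    rw [← lintegral_eq_lintegral_tsum_add_mul (hHm.enorm.pow_const 2) hp]
    have := (eLpNorm_lt_top_iff_lintegral_rpow_enorm_lt_top (by norm_num) (by norm_num)).1
      (Lp.memLp H).2
    simpa using this.ne
  have hfin : ∀ n : ℤ, ∫⁻ x in Set.Ioc 0 α⁻¹,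
      ‖∑' k : ℤ, (Φ (x + k * α⁻¹ + β * n) : ℂ) * H (x + k * α⁻¹)‖ₑ ^ 2 ≠ ∞ := by
    intro n
    refine ne_top_of_le_ne_top (ENNReal.mul_ne_top hB hHfin) ?_
    rw [← lintegral_const_mul' _ _ hB]
    refine lintegral_mono fun x => ?_
    exact (ENNReal.le_tsum (f := fun n : ℤ =>
      ‖∑' k : ℤ, (Φ (x + k * α⁻¹ + β * n) : ℂ) * H (x + k * α⁻¹)‖ₑ ^ 2) n).trans
      (hB' x fun k => H (x + k * α⁻¹))
  have hinner : ∀ i : ℤ × ℤ,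
      ‖inner ℂ ((memLp_timeFreqShift (-(β * i.2)) (α * i.1) hu).toLp) H‖ₑ ^ 2
      = ‖c‖ₑ ^ 2 * ‖∫ x : ℝ, Complex.exp (-(2 * Real.pi * Complex.I * i.1 * x / (α⁻¹ : ℝ)))
          * ((Φ (x + β * i.2) : ℂ) * H x)‖ₑ ^ 2 := by
    intro i
    rw [L2.inner_def, ← mul_pow]
    have : ∫ x, inner ℂ ((memLp_timeFreqShift (-(β * i.2)) (α * i.1) hu).toLp _ x) (H x)
        = starRingEnd ℂ c * ∫ x : ℝ,
          Complex.exp (-(2 * Real.pi * Complex.I * i.1 * x / (α⁻¹ : ℝ)))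
          * ((Φ (x + β * i.2) : ℂ) * H x) := by
      rw [← integral_const_mul]
      refine integral_congr_ae ?_
      filter_upwards [(memLp_timeFreqShift (-(β * i.2)) (α * i.1) hu).coeFn_toLp] with x hx
      rw [hx, RCLike.inner_apply, timeFreqShift]
      simp only [map_mul, ← Complex.exp_conj, Complex.conj_ofReal, Complex.conj_I, map_ofNat,
        sub_neg_eq_add]
      rw [show (2 * Real.pi * -Complex.I * (α * i.1 : ℝ) * x : ℂ)
        = -(2 * Real.pi * Complex.I * i.1 * x / (α⁻¹ : ℝ)) by
          push_cast; rw [div_inv_eq_mul]; ring]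
      ring
    rw [this, enorm_mul, RCLike.enorm_conj]
  rw [tsum_congr hinner]
  rw [ENNReal.tsum_mul_left, mul_assoc (‖c‖ₑ ^ 2), ENNReal.tsum_prod', ENNReal.tsum_comm,
    lintegral_tsum hPm, ← ENNReal.tsum_mul_left (a := ENNReal.ofReal α⁻¹)]
  refine congrArg _ (tsum_congr fun n => ?_)
  exact tsum_enorm_sq_integral_exp_mul (hF n) hp (hfin n)

/-- The Fourier transform of a nonzero multiple of a Kaluza window generates a Gabor frame. -/
theorem isGaborFrame_fourier (h : IsKaluzaWindow Φ b M) {α β : ℝ} (hα : 0 < α) (hβ : 0 < β)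
    (hαβ : α * β ≤ 1) {c : ℂ} (hc : c ≠ 0) :
    IsGaborFrame (𝓕 fun x => c * (Φ x : ℂ)) α β := by
  have hp : 0 < α⁻¹ := inv_pos.2 hα
  -- The density condition: β does not exceed the period.
  have hβp : β ≤ α⁻¹ := by rw [← one_div, le_div_iff₀ hα]; linarith
  have h1 : Integrable fun x => c * (Φ x : ℂ) := h.integrable.ofReal.const_mul c
  have h2 : MemLp (fun x => c * (Φ x : ℂ)) 2 volume := h.memLp_two.ofReal.const_mul c
  have hg := memLp_fourier h1 h2
  refine ⟨hg, ?_⟩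
  obtain ⟨B, hB, hB'⟩ := h.exists_tsum_enorm_sq_le hβ hp
  obtain ⟨C, hC, hC'⟩ := h.exists_le_tsum_enorm_sq hβ hβp
  set K : ℝ≥0∞ := ‖c‖ₑ ^ 2 * ENNReal.ofReal α⁻¹ with hK
  have hK0 : K ≠ 0 := mul_ne_zero (by simpa using hc) (by simpa using hα)
  have hKtop : K ≠ ∞ := ENNReal.mul_ne_top (by simp) (by simp)
  have hsum : ∀ H : Lp ℂ 2 (volume : Measure ℝ),
      ∑' i, ‖inner ℂ (gaborSystem _ hg α β i) H‖ₑ ^ 2 = K * ∫⁻ x in Set.Ioc 0 α⁻¹,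
        ∑' n : ℤ, ‖∑' k : ℤ, (Φ (x + k * α⁻¹ + β * n) : ℂ)
          * (𝓕⁻ H : Lp ℂ 2 (volume : Measure ℝ)) (x + k * α⁻¹)‖ₑ ^ 2 := by
    intro H
    rw [hK, ← h.tsum_inner_sq hα hβ c h2]
    refine tsum_congr fun i => ?_
    have := norm_inner_gaborSystem_fourier h1 h2 hg α β i (𝓕⁻ H : Lp ℂ 2 (volume : Measure ℝ))
    rw [FourierTransform.fourier_fourierInv_eq] at this
    rw [← ofReal_norm, this, ofReal_norm]
  have hnorm : ∀ H : Lp ℂ 2 (volume : Measure ℝ), ‖H‖ₑ ^ 2 = ∫⁻ x in Set.Ioc 0 α⁻¹,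
      ∑' k : ℤ, ‖(𝓕⁻ H : Lp ℂ 2 (volume : Measure ℝ)) (x + k * α⁻¹)‖ₑ ^ 2 := by
    intro H
    rw [← lintegral_eq_lintegral_tsum_add_mul ((Lp.aestronglyMeasurable _).enorm.pow_const 2) hp]
    have e1 : ‖H‖ₑ = ‖(𝓕⁻ H : Lp ℂ 2 (volume : Measure ℝ))‖ₑ := by
      rw [← ofReal_norm, ← ofReal_norm,
        ← Lp.norm_fourier_eq (𝓕⁻ H : Lp ℂ 2 (volume : Measure ℝ)),
        FourierTransform.fourier_fourierInv_eq]
    rw [e1, Lp.enorm_def, eLpNorm_eq_lintegral_rpow_enorm_toReal (by norm_num) (by norm_num),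
      ← ENNReal.rpow_natCast, ← ENNReal.rpow_mul]
    simp
  refine IsHilbertFrame.of_enorm (K := K) (C := C) (B := K * B) hK0 hKtop hC
    (ENNReal.mul_ne_top hKtop hB) (fun H => ?_) (fun H => ?_)
  · rw [hsum, mul_left_comm, hnorm, ← lintegral_const_mul' _ _ hC]
    refine mul_le_mul_right (lintegral_mono_ae ?_) K
    have hm : ∀ k : ℤ, AEMeasurable
        (fun x => ‖(𝓕⁻ H : Lp ℂ 2 (volume : Measure ℝ)) (x + k * α⁻¹)‖ₑ ^ 2)
        (volume.restrict (Set.Ioc 0 α⁻¹)) := fun k =>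
      (((Lp.aestronglyMeasurable _).comp_quasiMeasurePreserving (measurePreserving_add_right
        volume ((k : ℝ) * α⁻¹)).quasiMeasurePreserving).restrict.enorm).pow_const 2
    -- The lower bound needs a square-summable fibre, which holds for almost every x.
    have hlt := ae_lt_top' (AEMeasurable.tsum hm) (by rw [← hnorm]; simp)
    filter_upwards [hlt] with x hx
    exact hC' x (fun k => (𝓕⁻ H : Lp ℂ 2 (volume : Measure ℝ)) (x + k * α⁻¹)) hx.ne
  · rw [hsum, mul_assoc K B, hnorm, ← lintegral_const_mul' _ _ hB]
    exact mul_le_mul_right (lintegral_mono fun x =>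
      hB' x fun k => (𝓕⁻ H : Lp ℂ 2 (volume : Measure ℝ)) (x + k * α⁻¹)) K

end IsKaluzaWindow

/-! ### The Laplace window and the Cauchy transform. -/

/-- The Laplace transform of `μ` at `2 π x`, cut off to the positive half-line. -/
noncomputable def laplaceWindow (μ : Measure ℝ) (x : ℝ) : ℝ :=
  (Set.Ioi (0 : ℝ)).indicator (fun x => ∫ t, Real.exp (-(2 * Real.pi * x) * t) ∂μ) x

theorem ae_le_of_measure_Iio_eq_zero {a : ℝ} {μ : Measure ℝ} (hsupp : μ (Set.Iio a) = 0) :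
    ∀ᵐ t ∂μ, a ≤ t := by
  rw [ae_iff]; simpa [not_le, Set.Iio] using hsupp

section

variable {a : ℝ} {μ : Measure ℝ} [IsFiniteMeasure μ]

theorem integrable_exp_neg_mul (ha : 0 < a) (hsupp : μ (Set.Iio a) = 0) {r : ℝ} (hr : 0 ≤ r) :
    Integrable (fun t => Real.exp (-r * t)) μ := by
  refine (integrable_const (1 : ℝ)).mono' (by fun_prop) ?_
  filter_upwards [ae_le_of_measure_Iio_eq_zero hsupp] with t ht
  rw [Real.norm_of_nonneg (Real.exp_pos _).le, Real.exp_le_one_iff]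
  nlinarith

/-- Chebyshev's symmetrization: (e^{-sτ} - e^{-sσ})(e^{-tτ} - e^{-tσ}) ≥ 0, both factors being
monotone in the same direction. Integrate against e^{-x(τ+σ)} dμ(τ) dμ(σ). -/
theorem integral_exp_mul_integral_exp_le (ha : 0 < a) (hsupp : μ (Set.Iio a) = 0) {x s t : ℝ}
    (hx : 0 ≤ x) (hs : 0 ≤ s) (ht : 0 ≤ t) :
    (∫ τ, Real.exp (-(x + s) * τ) ∂μ) * ∫ τ, Real.exp (-(x + t) * τ) ∂μ
      ≤ (∫ τ, Real.exp (-(x + s + t) * τ) ∂μ) * ∫ τ, Real.exp (-x * τ) ∂μ := by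
  have hI : ∀ r : ℝ, 0 ≤ r → Integrable (fun t => Real.exp (-r * t)) μ := fun r hr =>
    integrable_exp_neg_mul ha hsupp hr
  have i1 := (hI (x + s + t) (by positivity)).mul_prod (hI x hx)
  have i2 := (hI (x + s) (by positivity)).mul_prod (hI (x + t) (by positivity))
  have i3 := (hI (x + t) (by positivity)).mul_prod (hI (x + s) (by positivity))
  have i4 := (hI x hx).mul_prod (hI (x + s + t) (by positivity))
  have hnn : 0 ≤ ∫ z : ℝ × ℝ, (Real.exp (-(x + s + t) * z.1) * Real.exp (-x * z.2)
      - Real.exp (-(x + s) * z.1) * Real.exp (-(x + t) * z.2)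
      - Real.exp (-(x + t) * z.1) * Real.exp (-(x + s) * z.2)
      + Real.exp (-x * z.1) * Real.exp (-(x + s + t) * z.2)) ∂(μ.prod μ) := by
    refine integral_nonneg fun z => ?_
    have e : ∀ r q w : ℝ, Real.exp (-(r + q) * w) = Real.exp (-r * w) * Real.exp (-q * w) :=
      fun r q w => by rw [← Real.exp_add]; ring_nf
    simp only [Pi.zero_apply, e]
    have key : 0 ≤ (Real.exp (-s * z.1) - Real.exp (-s * z.2))
        * (Real.exp (-t * z.1) - Real.exp (-t * z.2)) := by
      rcases le_total z.1 z.2 with hz | hz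
      · refine mul_nonneg (sub_nonneg.2 (Real.exp_le_exp.2 ?_))
          (sub_nonneg.2 (Real.exp_le_exp.2 ?_)) <;> nlinarith
      · refine mul_nonneg_of_nonpos_of_nonpos (sub_nonpos.2 (Real.exp_le_exp.2 ?_))
          (sub_nonpos.2 (Real.exp_le_exp.2 ?_)) <;> nlinarith
    have := mul_nonneg (mul_pos (Real.exp_pos (-x * z.1)) (Real.exp_pos (-x * z.2))).le key
    refine this.trans_eq ?_
    ring
  have i12 := i1.sub i2
  have i123 := i12.sub i3
  simp only [Pi.sub_def] at i12 i123
  rw [integral_add i123 i4, integral_sub i12 i3, integral_sub i1 i2,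
    integral_prod_mul (fun τ => Real.exp (-(x + s + t) * τ)) (fun τ => Real.exp (-x * τ)),
    integral_prod_mul (fun τ => Real.exp (-(x + s) * τ)) (fun τ => Real.exp (-(x + t) * τ)),
    integral_prod_mul (fun τ => Real.exp (-(x + t) * τ)) (fun τ => Real.exp (-(x + s) * τ)),
    integral_prod_mul (fun τ => Real.exp (-x * τ)) (fun τ => Real.exp (-(x + s + t) * τ))] at hnn
  linarith

theorem isKaluzaWindow_laplaceWindow (ha : 0 < a) (hμ : μ ≠ 0) (hsupp : μ (Set.Iio a) = 0) :
    IsKaluzaWindow (laplaceWindow μ) (2 * Real.pi * a) (μ.real Set.univ) := by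
  have : NeZero μ := ⟨hμ⟩
  have hval : ∀ x : ℝ, 0 < x →
      laplaceWindow μ x = ∫ t, Real.exp (-(2 * Real.pi * x) * t) ∂μ := fun x hx =>
    Set.indicator_of_mem (Set.mem_Ioi.2 hx) _
  have hpi := Real.pi_pos
  have hI : ∀ x : ℝ, 0 < x → Integrable (fun t => Real.exp (-(2 * Real.pi * x) * t)) μ :=
    fun x hx => integrable_exp_neg_mul ha hsupp (by positivity)
  refine ⟨by positivity, fun x hx => Set.indicator_of_notMem (by simpa using hx) _,
    fun x hx => ?_, fun x y hx hxy => ?_, fun x s t hx hs ht => ?_, fun x hx => ?_⟩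
  · rw [hval x hx]
    exact integral_exp_pos (hI x hx)
  · rw [hval x hx, hval y (hx.trans_le hxy)]
    refine integral_mono_ae (hI y (hx.trans_le hxy)) (hI x hx) ?_
    filter_upwards [ae_le_of_measure_Iio_eq_zero hsupp] with t ht
    refine Real.exp_le_exp.2 ?_
    have h1 : 2 * Real.pi * x ≤ 2 * Real.pi * y := by gcongr
    nlinarith
  · rw [hval _ hx, hval (x + s) (by positivity), hval (x + t) (by positivity),
      hval (x + s + t) (by positivity)]
    simp only [mul_add]
    exact integral_exp_mul_integral_exp_le ha hsupp (by positivity) (by positivity)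
      (by positivity)
  · rw [hval x hx, ← smul_eq_mul (μ.real Set.univ), ← integral_const]
    refine integral_mono_ae (hI x hx) (integrable_const _) ?_
    filter_upwards [ae_le_of_measure_Iio_eq_zero hsupp] with t ht
    refine Real.exp_le_exp.2 ?_
    have h1 : 0 < 2 * Real.pi * x := by positivity
    nlinarith

/-- Integrate the formula for 1/(y - it) over μ and apply Fubini; t ≥ a > 0 gives the integrable
majorant e^{-2πax}. -/
theorem cauchyTransform_eq_fourier (ha : 0 < a) (hsupp : μ (Set.Iio a) = 0) :
    cauchyTransform μ = 𝓕 fun x => (2 * Real.pi * Complex.I) * (laplaceWindow μ x : ℂ) := by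
  ext y
  have hpi := Real.pi_pos
  set ν : Measure ℝ := volume.restrict (Set.Ioi 0)
  have hF : Integrable (Function.uncurry fun (x t : ℝ) =>
      Complex.exp (-(2 * Real.pi * (t + Complex.I * y)) * x)) (ν.prod μ) := by
    have hdom : Integrable (fun z : ℝ × ℝ => Real.exp (-(2 * Real.pi * a) * z.1) * 1)
        (ν.prod μ) :=
      (exp_neg_integrableOn_Ioi 0 (by positivity : 0 < 2 * Real.pi * a)).mul_prod
        (integrable_const (1 : ℝ))
    refine hdom.mono' (Continuous.aestronglyMeasurable (by
      simp only [Function.uncurry_def]; fun_prop)) ?_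
    have h1 : ∀ᵐ z ∂(ν.prod μ), a ≤ z.2 :=
      Measure.quasiMeasurePreserving_snd.ae (ae_le_of_measure_Iio_eq_zero hsupp)
    have h2 : ∀ᵐ z ∂(ν.prod μ), z.1 ∈ Set.Ioi (0 : ℝ) :=
      Measure.quasiMeasurePreserving_fst.ae (ae_restrict_mem measurableSet_Ioi)
    filter_upwards [h1, h2] with z hz1 hz2
    rw [Function.uncurry_def, Complex.norm_exp, mul_one]
    refine Real.exp_le_exp.2 ?_
    have : (-(2 * Real.pi * ((z.2 : ℂ) + Complex.I * y)) * z.1).re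
        = -(2 * Real.pi * z.2) * z.1 := by simp
    rw [this]
    have h3 : 0 < 2 * Real.pi * z.1 := mul_pos (by positivity) hz2
    nlinarith
  have hswap := integral_integral_swap hF
  have hin : ∀ᵐ t : ℝ ∂μ, ∫ x : ℝ, Complex.exp (-(2 * Real.pi * (t + Complex.I * y)) * x) ∂ν
      = (2 * Real.pi * Complex.I)⁻¹ * (1 / ((y : ℂ) - Complex.I * t)) := by
    filter_upwards [ae_le_of_measure_Iio_eq_zero hsupp] with t ht
    have ht0 : 0 < t := ha.trans_le ht
    rw [integral_exp_mul_complex_Ioi (by simpa using mul_pos (by positivity) ht0)]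
    have hne : (t : ℂ) + Complex.I * y ≠ 0 := fun h0 => by
      have := congrArg Complex.re h0
      simp at this
      exact ht0.ne' this
    have e : (y : ℂ) - Complex.I * t = -Complex.I * (t + Complex.I * y) := by
      linear_combination (y : ℂ) * Complex.I_mul_I
    have hpi' : (Real.pi : ℂ) ≠ 0 := by exact_mod_cast hpi.ne'
    rw [e]
    simp only [Complex.ofReal_zero, mul_zero, Complex.exp_zero]
    have hI := Complex.I_ne_zero
    field_simp
    simp
  have hout : ∀ x : ℝ, 0 < x → ∫ t : ℝ, Complex.exp (-(2 * Real.pi * (t + Complex.I * y)) * x) ∂μ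
      = Complex.exp (((-2 * Real.pi * x * y : ℝ) : ℂ) * Complex.I) * (laplaceWindow μ x : ℂ) := by
    intro x hx
    rw [laplaceWindow, Set.indicator_of_mem (Set.mem_Ioi.2 hx), ← integral_complex_ofReal,
      ← integral_const_mul]
    refine integral_congr_ae (Eventually.of_forall fun t => ?_)
    simp only [Complex.ofReal_exp, ← Complex.exp_add]
    congr 1
    push_cast
    ring
  have h2pi : (2 * Real.pi * Complex.I : ℂ) ≠ 0 := Complex.two_pi_I_ne_zero
  calc cauchyTransform μ y
      = (2 * Real.pi * Complex.I) * ∫ t : ℝ, (∫ x : ℝ,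
          Complex.exp (-(2 * Real.pi * (t + Complex.I * y)) * x) ∂ν) ∂μ := by
        rw [integral_congr_ae hin, integral_const_mul, mul_inv_cancel_left₀ h2pi, cauchyTransform]
    _ = (2 * Real.pi * Complex.I) * ∫ x in Set.Ioi (0 : ℝ),
          Complex.exp (((-2 * Real.pi * x * y : ℝ) : ℂ) * Complex.I)
            * (laplaceWindow μ x : ℂ) := by
        rw [← hswap]
        congr 1
        exact setIntegral_congr_fun measurableSet_Ioi fun x hx => hout x hx
    _ = _ := by
        rw [Real.fourier_real_eq_integral_exp_smul, setIntegral_eq_integral_of_forall_compl_eq_zero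
          fun x hx => by rw [laplaceWindow, Set.indicator_of_notMem hx]; simp,
          ← integral_const_mul]
        refine integral_congr_ae (Eventually.of_forall fun x => ?_)
        simp only [smul_eq_mul]
        ring

end

theorem mainTheorem2 (a : ℝ) (ha : 0 < a) (μ : Measure ℝ) [IsFiniteMeasure μ]
    (hμ : μ ≠ 0) (hsupp : μ (Set.Iio a) = 0)
    (α β : ℝ) (hα : 0 < α) (hβ : 0 < β) (hαβ : α * β ≤ 1) :
    IsGaborFrame (cauchyTransform μ) α β := by
  rw [cauchyTransform_eq_fourier ha hsupp]
  exact (isKaluzaWindow_laplaceWindow ha hμ hsupp).isGaborFrame_fourier hα hβ hαβ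
    Complex.two_pi_I_ne_zero
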